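/- Let $k$ be a field. A Nakayama algebra over $k$ is an algebra isomorphic to $kQ/I$, where, for some $m\ge 1$, $Q$ is either the linearly oriented quiver $1\to 2\to\cdots\to m$ of type $\mathbb A_m$ or the oriented cycle with $m$ vertices (one arrow $i\to i+1$ for each $i$ modulo $m$), and $I$ is an admissible ideal of the path algebra $kQ$, i.e. a two-sided ideal with $Q_{\ge t}\subseteq I\subseteq Q_{\ge 2}$ for some $t\ge 2$, where $Q_{\ge t}$ is the two-sided ideal generated by the paths of length $t$. Let $\operatorname{gldim}\Lambda$ be the supremum of the projective dimensions of the finitely generated left $\Lambda$-modules, and let the Loewy length of $\Lambda$ be the least $d\ge 1$ with $(\operatorname{rad}\Lambda)^d=0$. (1) If $\Lambda$ is a Nakayama algebra over $k$ of finite global dimension with exactly $n$ simple left modules up to isomorphism, then $\operatorname{gldim}\Lambda\le 2n-2$, and the Loewy length of $\Lambda$ is at most $2n-1$. (2) The first bound is attained on the oriented cycle: for every $n\ge 2$ there is an admissible ideal $I$ of the path algebra $kQ$ of the oriented cycle $Q$ with $n$ vertices such that $\operatorname{gldim} kQ/I=2n-2$. -/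

import Mathlib

open CategoryTheory

universe u v w

noncomputable section

namespace NakayamaBound

/-! ### Path algebras -/

/-- All paths of a quiver `V`: a source, a target and a path between them
(the trivial paths `Quiver.Path.nil` are included). -/
abbrev AnyPath (V : Type v) [Quiver.{w} V] : Type _ :=
  Σ a b : V, Quiver.Path a b

/-- The underlying vector space of the path algebra `kQ`: it has the paths of `Q` as a basis. -/
def PathAlgebra (k : Type u) [Field k] (V : Type v) [Quiver.{w} V] : Type _ :=
  AnyPath V →₀ k

namespace PathAlgebra

variable {k : Type u} [Field k] {V : Type v} [Quiver.{w} V]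

instance : AddCommGroup (PathAlgebra k V) :=
  inferInstanceAs (AddCommGroup (AnyPath V →₀ k))

instance : Module k (PathAlgebra k V) :=
  inferInstanceAs (Module k (AnyPath V →₀ k))

variable (k) in
/-- The basis element of `kQ` that belongs to a path. -/
def ofPath (p : AnyPath V) : PathAlgebra k V :=
  Finsupp.single p (1 : k)

variable (k V) in
/-- The paths form a basis of `kQ`. -/
def basis : Module.Basis (AnyPath V) k (PathAlgebra k V) :=
  Module.Basis.ofRepr (LinearEquiv.refl k (AnyPath V →₀ k))

theorem basis_apply (p : AnyPath V) : basis k V p = ofPath k p := rfl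

open Classical in
variable (k) in
/-- The product of two paths: "first `p`, then `q`" if `q` starts where `p` ends, and `0`
otherwise. -/
def pathProd (p q : AnyPath V) : PathAlgebra k V :=
  if h : q.1 = p.2.1 then ofPath k ⟨p.1, q.2.1, p.2.2.comp (q.2.2.cast h rfl)⟩ else 0

variable (k V) in
/-- The multiplication of `kQ`: the bilinear extension of the product of paths. -/
def mulLin : PathAlgebra k V →ₗ[k] PathAlgebra k V →ₗ[k] PathAlgebra k V :=
  (basis k V).constr k fun p => (basis k V).constr k fun q => pathProd k p q

instance : Mul (PathAlgebra k V) := ⟨fun x y => mulLin k V x y⟩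

theorem mul_def (x y : PathAlgebra k V) : x * y = mulLin k V x y := rfl

theorem ofPath_mul_ofPath (p q : AnyPath V) :
    ofPath k p * ofPath k q = pathProd k p q := by
  rw [mul_def, mulLin, ← basis_apply, ← basis_apply, Module.Basis.constr_basis,
    Module.Basis.constr_basis]

theorem ofPath_mul_ofPath_comp {a b c : V} (p : Quiver.Path a b) (q : Quiver.Path b c) :
    ofPath k ⟨a, b, p⟩ * ofPath k ⟨b, c, q⟩ = ofPath k ⟨a, c, p.comp q⟩ := by
  rw [ofPath_mul_ofPath, pathProd, dif_pos rfl]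
  rfl

theorem ofPath_mul_ofPath_of_ne {a b c d : V} (p : Quiver.Path a b) (q : Quiver.Path c d)
    (h : c ≠ b) : ofPath k ⟨a, b, p⟩ * ofPath k ⟨c, d, q⟩ = 0 := by
  rw [ofPath_mul_ofPath, pathProd, dif_neg h]

/-- Induction on `kQ`: a property closed under sums holds if it holds for multiples of paths. -/
theorem induction {P : PathAlgebra k V → Prop} (x : PathAlgebra k V)
    (h0 : P 0) (hadd : ∀ x y, P x → P y → P (x + y))
    (hp : ∀ (c : k) (p : AnyPath V), P (c • ofPath k p)) : P x := by
  refine Finsupp.induction_linear (motive := P) x h0 hadd ?_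
  intro p c
  have h : (Finsupp.single p c : AnyPath V →₀ k) = c • Finsupp.single p (1 : k) := by simp
  rw [h]
  exact hp c p

variable [Fintype V]

/-- The unit of `kQ`: the sum of the trivial paths. -/
instance : One (PathAlgebra k V) :=
  ⟨∑ a : V, ofPath k ⟨a, a, Quiver.Path.nil⟩⟩

theorem one_def : (1 : PathAlgebra k V) = ∑ a : V, ofPath k ⟨a, a, Quiver.Path.nil⟩ := rfl

instance : Ring (PathAlgebra k V) :=
  { (inferInstance : AddCommGroup (PathAlgebra k V)),
    (inferInstance : Mul (PathAlgebra k V)),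
    (inferInstance : One (PathAlgebra k V)) with
    left_distrib := fun x y z => by simp only [mul_def, map_add]
    right_distrib := fun x y z => by simp only [mul_def, map_add, LinearMap.add_apply]
    zero_mul := fun x => by simp only [mul_def, map_zero, LinearMap.zero_apply]
    mul_zero := fun x => by simp only [mul_def, map_zero]
    mul_assoc := fun x y z => by
      have key : ∀ p q r : AnyPath V,
          ofPath k p * ofPath k q * ofPath k r = ofPath k p * (ofPath k q * ofPath k r) := by
        rintro ⟨a, b, p⟩ ⟨c, d, q⟩ ⟨e, f, r⟩
        by_cases h1 : c = b
        · subst h1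
          by_cases h2 : e = d
          · subst h2
            simp only [ofPath_mul_ofPath_comp, Quiver.Path.comp_assoc]
          · rw [ofPath_mul_ofPath_comp, ofPath_mul_ofPath_of_ne _ _ h2,
              ofPath_mul_ofPath_of_ne _ _ h2, mul_def, map_zero]
        · rw [ofPath_mul_ofPath_of_ne _ _ h1]
          by_cases h2 : e = d
          · subst h2
            rw [ofPath_mul_ofPath_comp, ofPath_mul_ofPath_of_ne _ _ h1, mul_def, map_zero,
              LinearMap.zero_apply]
          · rw [ofPath_mul_ofPath_of_ne _ _ h2, mul_def, mul_def, map_zero, map_zero,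
              LinearMap.zero_apply]
      simp only [mul_def] at key ⊢
      induction x using induction with
      | h0 => simp
      | hadd x₁ x₂ h₁ h₂ => simp [h₁, h₂]
      | hp a p =>
        induction y using induction with
        | h0 => simp
        | hadd x₁ x₂ h₁ h₂ =>
          simp only [map_add, LinearMap.add_apply] at h₁ h₂ ⊢
          rw [h₁, h₂]
        | hp b q =>
          induction z using induction with
          | h0 => simp
          | hadd x₁ x₂ h₁ h₂ =>
            simp only [map_add] at h₁ h₂ ⊢
            rw [h₁, h₂]
          | hp c r => simp only [map_smul, LinearMap.smul_apply, key]
    one_mul := fun x => by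
      simp only [mul_def]
      induction x using induction with
      | h0 => simp
      | hadd x₁ x₂ h₁ h₂ => rw [map_add, h₁, h₂]
      | hp c p =>
        obtain ⟨a, b, p⟩ := p
        rw [map_smul, one_def, map_sum, LinearMap.sum_apply, Finset.sum_eq_single a]
        · rw [← mul_def, ofPath_mul_ofPath_comp, Quiver.Path.nil_comp]
        · intro c _ hc
          rw [← mul_def, ofPath_mul_ofPath_of_ne _ _ hc.symm]
        · simp
    mul_one := fun x => by
      simp only [mul_def]
      induction x using induction with
      | h0 => simp
      | hadd x₁ x₂ h₁ h₂ => rw [map_add, LinearMap.add_apply, h₁, h₂]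
      | hp c p =>
        obtain ⟨a, b, p⟩ := p
        rw [map_smul, LinearMap.smul_apply, one_def, map_sum, Finset.sum_eq_single b]
        · rw [← mul_def, ofPath_mul_ofPath_comp, Quiver.Path.comp_nil]
        · intro c _ hc
          rw [← mul_def, ofPath_mul_ofPath_of_ne _ _ hc]
        · simp }

/-- The path algebra is an algebra over `k`. -/
instance : Algebra k (PathAlgebra k V) :=
  Algebra.ofModule
    (fun r x y => by simp only [mul_def, map_smul, LinearMap.smul_apply])
    (fun r x y => by simp only [mul_def, map_smul])

variable (k V) in
/-- The two-sided ideal of `kQ` generated by the paths of length `t`. -/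
def pathIdeal (t : ℕ) : TwoSidedIdeal (PathAlgebra k V) :=
  TwoSidedIdeal.span {x | ∃ p : AnyPath V, p.2.2.length = t ∧ x = ofPath k p}

/-- An ideal `I` of `kQ` is admissible if it is two-sided and lies between the ideal generated by
the paths of some length `t ≥ 2` and the ideal generated by the paths of length `2`. -/
structure IsAdmissible (I : Ideal (PathAlgebra k V)) : Prop where
  isTwoSided : I.IsTwoSided
  exists_le : ∃ t : ℕ, 2 ≤ t ∧ ∀ x ∈ pathIdeal k V t, x ∈ I
  le_two : ∀ x ∈ I, x ∈ pathIdeal k V 2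

end PathAlgebra

/-! ### Nakayama algebras -/

/-- The vertices of the linearly oriented quiver of type `A_n`. -/
def LinearQuiver (n : ℕ) : Type := Fin n

instance (n : ℕ) : Fintype (LinearQuiver n) := inferInstanceAs (Fintype (Fin n))

/-- The arrows of `0 → 1 → ⋯ → n - 1`: exactly one from `i` to `i + 1`. -/
instance (n : ℕ) : Quiver.{0} (LinearQuiver n) where
  Hom (i j : Fin n) := PLift (i.val + 1 = j.val)

/-- The vertices of the oriented cycle with `n` vertices. -/
def CyclicQuiver (n : ℕ) : Type := Fin n

instance (n : ℕ) : Fintype (CyclicQuiver n) := inferInstanceAs (Fintype (Fin n))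

/-- The arrows of `0 → 1 → ⋯ → n - 1 → 0`: exactly one from `i` to `i + 1` modulo `n`
(a single loop if `n = 1`). -/
instance (n : ℕ) : Quiver.{0} (CyclicQuiver n) where
  Hom (i j : Fin n) := PLift ((i.val + 1) % n = j.val)

/-- `Λ` is isomorphic, as a `k`-algebra, to the quotient of `kQ` by an admissible ideal. -/
def IsAdmissibleQuotient (k : Type u) [Field k] (V : Type) [Quiver.{0} V] [Fintype V]
    (Λ : Type v) [Ring Λ] [Algebra k Λ] : Prop :=
  ∃ (I : Ideal (PathAlgebra k V)) (hI : PathAlgebra.IsAdmissible I),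
    letI := hI.isTwoSided
    Nonempty (Λ ≃ₐ[k] (PathAlgebra k V ⧸ I))

/-- A Nakayama algebra over `k`: a quotient, by an admissible ideal, of the path algebra of a
linearly oriented quiver of type `A_m` or of an oriented cycle with `m` vertices, `m ≥ 1`. -/
def IsNakayama (k : Type u) [Field k] (Λ : Type v) [Ring Λ] [Algebra k Λ] : Prop :=
  ∃ m : ℕ, 1 ≤ m ∧
    (IsAdmissibleQuotient k (LinearQuiver m) Λ ∨ IsAdmissibleQuotient k (CyclicQuiver m) Λ)

/-! ### Invariants of a ring -/

/-- `Λ` has exactly `n` simple left modules up to isomorphism. -/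
def HasNumSimples (Λ : Type v) [Ring Λ] (n : ℕ) : Prop :=
  ∃ S : Fin n → ModuleCat.{v} Λ,
    (∀ i, IsSimpleModule Λ (S i)) ∧
    (∀ i j, Nonempty (S i ≃ₗ[Λ] S j) → i = j) ∧
    ∀ M : ModuleCat.{v} Λ, IsSimpleModule Λ M → ∃ i, Nonempty (M ≃ₗ[Λ] S i)

/-- The global dimension of a finite-dimensional algebra: the supremum of the projective
dimensions of its finitely generated left modules. -/
def globalDimension (Λ : Type v) [Ring Λ] : WithBot ℕ∞ :=
  ⨆ (M : ModuleCat.{v} Λ) (_ : Module.Finite Λ M), projectiveDimension M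

/-- The Loewy length: the least positive `d` such that the `d`-th power of the Jacobson radical
vanishes (and `⊤` if there is none). -/
def loewyLength (Λ : Type v) [Ring Λ] : ℕ∞ :=
  ⨅ (d : ℕ) (_ : 0 < d ∧ Ring.jacobson Λ ^ d = ⊥), (d : ℕ∞)

end NakayamaBound

end

/-! Vertices are labelled by `ZMod n` and lifted to the integers. A path is determined by its target
and its length, so the indecomposable projective at `j` is uniserial, of some length `len j`. All
homological data sit in `shift x = x - len x`, written f, which commutes with translation by n and
is monotone (`monotone_shift`).

The submodule of the projective at u whose top is at v is covered by the projective at v, and its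
syzygy is the submodule there with top at f u (`isGenerator_interval`). Taking syzygies thus moves
one place along u, v, f u, f v, …; the module vanishes when v = f u and is projective when f u = f
v. Since the syzygy of the simple at x belongs to (x, x - 1), finite projective dimension of the
simples means that the sequences x, x - 1, f x, f (x - 1), … acquire equal neighbours.

If two f-orbits merge, they do so within n - 1 steps: up to the merger the image of the iterates
modulo n loses a residue at each step and it never becomes empty (`succ_lt_of_iterate_merge`). This
bounds the projective dimension of simples by 2n - 2, and finite length carries the bound to all
finitely generated modules. A projective of length at least 2n would make the (n - 1)-st iterate
constant on a full period, which equivariance forbids (`EventuallyMerges.sub_le`); this bounds the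
Loewy length. For sharpness, the lengths n, n + 1, …, n + 1 delay the merger that starts at 0 as
long as possible. -/

noncomputable section

namespace NakayamaBound

/-! ### Monotone equivariant maps of the integers -/

/-- The sequence `u, v, f u, f v, f (f u), …`. -/
def interleave (f : ℤ → ℤ) (u v : ℤ) : ℕ → ℤ
  | 0 => u
  | i + 1 => interleave f v (f u) i

theorem interleave_two_mul (f : ℤ → ℤ) (u v : ℤ) (r : ℕ) :
    interleave f u v (2 * r) = f^[r] u ∧ interleave f u v (2 * r + 1) = f^[r] v := by
  induction r generalizing u v with
  | zero => simp [interleave]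
  | succ r ih =>
    obtain ⟨h₁, h₂⟩ := ih (f u) (f v)
    refine ⟨?_, ?_⟩
    · rw [Function.iterate_succ_apply, ← h₁]; rfl
    · rw [Function.iterate_succ_apply, ← h₂]; rfl

section Equivariant

variable {n : ℕ} {f : ℤ → ℤ}

theorem add_mul_equivariant (hf : ∀ x, f (x + n) = f x + n) (x t : ℤ) :
    f (x + t * n) = f x + t * n := by
  induction t using Int.induction_on with
  | zero => simp
  | succ i ih => rw [add_mul, one_mul, ← add_assoc, hf, ih, add_assoc]
  | pred i ih =>
    have := hf (x + (-(i : ℤ) - 1) * n)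
    rw [show x + (-(i : ℤ) - 1) * n + n = x + -(i : ℤ) * n by ring, ih] at this
    linarith

theorem iterate_equivariant (hf : ∀ x, f (x + n) = f x + n) (r : ℕ) (x : ℤ) :
    f^[r] (x + n) = f^[r] x + n := by
  induction r generalizing x with
  | zero => rfl
  | succ r ih => rw [Function.iterate_succ_apply, hf, ih, Function.iterate_succ_apply]

/-- If two orbits merge exactly at step `r + 1`, then the images of the iterates modulo `n` have
been shrinking strictly up to that step. -/
theorem succ_lt_of_iterate_merge [NeZero n] (hf : ∀ x, f (x + n) = f x + n) {r : ℕ} {y z : ℤ}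
    (h : f^[r + 1] y = f^[r + 1] z) (hne : f^[r] y ≠ f^[r] z) : r + 1 < n := by
  classical
  let im : ℕ → Finset (ZMod n) := fun i =>
    (Finset.range n).image fun x : ℕ => ((f^[i] (x : ℤ) : ℤ) : ZMod n)
  have mem_im : ∀ i (x : ℤ), ((f^[i] x : ℤ) : ZMod n) ∈ im i := by
    intro i x
    have hn : (0 : ℤ) < n := by exact_mod_cast NeZero.pos n
    have h0 := Int.emod_nonneg x hn.ne'
    have h1 := Int.emod_lt_of_pos x hn
    refine Finset.mem_image.2 ⟨(x % n).toNat, ?_, ?_⟩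
    · simp only [Finset.mem_range]; omega
    · rw [Int.toNat_of_nonneg h0]
      conv_rhs => rw [← Int.emod_add_ediv_mul x n,
        add_mul_equivariant (iterate_equivariant hf i) (x % n) (x / n)]
      simp
  have hfbar : ∀ x y : ℤ, (x : ZMod n) = y → ((f x : ℤ) : ZMod n) = f y := by
    intro x y hxy
    obtain ⟨t, ht⟩ := (ZMod.intCast_eq_intCast_iff_dvd_sub x y n).1 hxy
    obtain rfl : y = x + t * n := by linarith
    rw [add_mul_equivariant hf]; simp
  have himage : ∀ i, im (i + 1) = (im i).image fun a => ((f (a.val : ℤ) : ℤ) : ZMod n) := by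
    intro i
    simp only [im, Finset.image_image]
    refine Finset.image_congr fun x _ => ?_
    simp only [Function.comp_apply, Function.iterate_succ_apply']
    exact hfbar _ _ (by simp)
  -- Were the cardinalities equal, f would be injective on `im i` modulo n. Then the r-th iterates
  -- of y and z differ by a multiple t * n, and their merger under f forces t * n = 0, against
  -- `hne`.
  have hlt : ∀ i ≤ r, (im (i + 1)).card < (im i).card := by
    intro i hi
    refine lt_of_le_of_ne (by rw [himage]; exact Finset.card_image_le) fun hcard => ?_
    rw [himage, Finset.card_image_iff] at hcard
    obtain ⟨s, rfl⟩ := Nat.exists_eq_add_of_le hi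
    have key : ((f^[i + s] y : ℤ) : ZMod n) = f^[i + s] z := by
      rw [Function.iterate_add_apply, Function.iterate_add_apply]
      refine hcard (mem_im i _) (mem_im i _) ?_
      have : ((f (f^[i] (f^[s] y)) : ℤ) : ZMod n) = (f (f^[i] (f^[s] z)) : ℤ) := by
        rw [← Function.iterate_add_apply, ← Function.iterate_add_apply,
          ← Function.iterate_succ_apply' f, ← Function.iterate_succ_apply' f, h]
      convert this using 1 <;> exact hfbar _ _ (by simp)
    obtain ⟨t, ht⟩ := (ZMod.intCast_eq_intCast_iff_dvd_sub _ _ n).1 key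
    have h' : f^[i + s] z = f^[i + s] y + t * n := by linarith
    rw [Function.iterate_succ_apply', Function.iterate_succ_apply', h',
      add_mul_equivariant hf] at h
    exact hne (by linarith)
  have hbound : ∀ i ≤ r + 1, (im i).card + i ≤ n := by
    intro i
    induction i with
    | zero => intro _; simpa using Finset.card_image_le (s := Finset.range n)
    | succ i ih => intro hi; have := hlt i (by omega); have := ih (by omega); omega
  have hpos : 0 < (im (r + 1)).card := Finset.card_pos.2 ⟨_, mem_im (r + 1) 0⟩
  have := hbound (r + 1) le_rfl
  omega

theorem iterate_eq_of_iterate_eq [NeZero n] (hf : ∀ x, f (x + n) = f x + n) {r : ℕ} {y z : ℤ}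
    (h : f^[r] y = f^[r] z) : f^[n - 1] y = f^[n - 1] z := by
  classical
  have hex : ∃ r, f^[r] y = f^[r] z := ⟨r, h⟩
  have hle : Nat.find hex ≤ n - 1 := by
    rcases hr : Nat.find hex with _ | s
    · omega
    · have h1 := Nat.find_spec hex
      rw [hr] at h1
      have := succ_lt_of_iterate_merge hf h1 (Nat.find_min hex (by omega))
      omega
  obtain ⟨s, hs⟩ := Nat.exists_eq_add_of_le hle
  rw [hs, add_comm, Function.iterate_add_apply, Function.iterate_add_apply, Nat.find_spec hex]

variable (f) in
/-- The interleaved sequences that start at neighbouring integers stop being strict. -/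
def EventuallyMerges : Prop :=
  ∀ x : ℤ, ∃ i, interleave f x (x - 1) (i + 1) = interleave f x (x - 1) (i + 2)

/-- Neighbours at an even place compare the orbits of x and x - 1, at an odd place those of x - 1
and f x. Either merger is complete by step n - 1. -/
theorem EventuallyMerges.iterate [NeZero n] (hf : ∀ x, f (x + n) = f x + n)
    (h : EventuallyMerges f) (x : ℤ) :
    f^[n - 1] x = f^[n - 1] (x - 1) ∨ f^[n - 1] (x - 1) = f^[n - 1] (f x) := by
  obtain ⟨i, hi⟩ := h x
  obtain ⟨r, hr | hr⟩ := Nat.even_or_odd' (i + 1)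
  · left
    rw [show i + 2 = 2 * r + 1 by omega, hr, (interleave_two_mul _ _ _ _).1,
      (interleave_two_mul _ _ _ _).2] at hi
    exact iterate_eq_of_iterate_eq hf hi
  · right
    rw [show i + 2 = 2 * (r + 1) by omega, hr, (interleave_two_mul _ _ _ _).1,
      (interleave_two_mul _ _ _ _).2, Function.iterate_succ_apply] at hi
    exact iterate_eq_of_iterate_eq hf hi

theorem EventuallyMerges.exists_le [NeZero n] (hf : ∀ x, f (x + n) = f x + n)
    (h : EventuallyMerges f) (x : ℤ) :
    ∃ i ≤ 2 * n - 2, interleave f x (x - 1) (i + 1) = interleave f x (x - 1) (i + 2) := by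
  have hn := NeZero.pos n
  rcases h.iterate hf x with hx | hx
  · obtain ⟨m, rfl⟩ : ∃ m, n = m + 1 := ⟨n - 1, by omega⟩
    -- For n = 1 the iterate is the identity, so this alternative would say x = x - 1.
    rcases m with _ | m
    · simp at hx
      omega
    · refine ⟨2 * m + 1, by omega, ?_⟩
      rw [show 2 * m + 1 + 1 = 2 * (m + 1) by ring, show 2 * m + 1 + 2 = 2 * (m + 1) + 1 by ring,
        (interleave_two_mul _ _ _ _).1, (interleave_two_mul _ _ _ _).2]
      exact hx
  · refine ⟨2 * (n - 1), by omega, ?_⟩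
    rw [show 2 * (n - 1) + 2 = 2 * (n - 1 + 1) by ring,
      (interleave_two_mul _ _ _ _).1, (interleave_two_mul _ _ _ _).2, Function.iterate_succ_apply]
    exact hx

/-- With g the (n - 1)-st iterate, a drop of 2n at j puts g (f j) too far below g j for the second
alternative of `EventuallyMerges.iterate` to hold near j. Hence g is constant from j down to j - n,
although it must fall by n. -/
theorem EventuallyMerges.sub_le [NeZero n] (hf : ∀ x, f (x + n) = f x + n) (hmono : Monotone f)
    (h : EventuallyMerges f) (j : ℤ) : j - f j ≤ 2 * n - 1 := by
  by_contra! hj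
  have hn : (0 : ℤ) < n := by exact_mod_cast NeZero.pos n
  set g := f^[n - 1] with hg
  have hgm : Monotone g := hmono.iterate _
  have hgp : ∀ x t : ℤ, g (x + t * n) = g x + t * n :=
    add_mul_equivariant (iterate_equivariant hf _)
  have hcomm : ∀ x, g (f x) = f (g x) := fun x => by
    rw [hg, ← Function.iterate_succ_apply, Function.iterate_succ_apply']
  have h2 : g (f j) ≤ g j - 2 * n := by
    have h3 := hgp j (-2)
    have := hgm (show f j ≤ j + -2 * n by linarith)
    linarith
  have hconst : ∀ i : ℕ, (i : ℤ) ≤ n → g (j - i) = g j := by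
    intro i
    induction i with
    | zero => simp
    | succ i ih =>
      intro hi
      push_cast at hi
      have ih' := ih (by linarith)
      rcases h.iterate hf (j - i) with hx | hx
      · push_cast; rw [← sub_sub, ← ih']; exact hx.symm
      -- Here g (j - i - 1) = f (g j) = g (f j) ≤ g j - 2n, while j - i - 1 ≥ j - n gives g (j - i -
      -- 1) ≥ g j - n.
      · exfalso
        change g _ = g _ at hx
        rw [hcomm, ih', ← hcomm] at hx
        have h3 := hgp j (-1)
        have := hgm (show j + -1 * n ≤ j - i - 1 by linarith)
        linarith
  have h1 := hconst n le_rfl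
  have h3 := hgp j (-1)
  rw [show j + -1 * (n : ℤ) = j - n by ring] at h3
  linarith

end Equivariant

/-! ### The extremal map -/

/-- The map of the integers that belongs to the algebra of maximal global dimension. -/
def extremalMap (n : ℕ) (x : ℤ) : ℤ := if (n : ℤ) ∣ x then x - n else x - (n + 1)

/-- In the coordinates q * n + t the map lowers the block q by one and the digit t by one, stopping
at 0; the natural subtraction encodes the stop. -/
theorem extremalMap_apply {n t : ℕ} (ht : t < n) (q : ℤ) :
    extremalMap n (q * n + t) = (q - 1) * n + (t - 1 : ℕ) := by
  unfold extremalMap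
  rcases t with _ | t
  · rw [if_pos (by simp)]; simp; ring
  · rw [if_neg]
    · rw [Nat.add_sub_cancel]; push_cast; ring
    · intro hd
      have : (n : ℤ) ∣ ((t + 1 : ℕ) : ℤ) := (Int.dvd_add_right (Dvd.intro_left q rfl)).1 hd
      have := Nat.le_of_dvd (by omega) (Int.natCast_dvd_natCast.1 this)
      omega

theorem iterate_extremalMap {n t : ℕ} (ht : t < n) (q : ℤ) (r : ℕ) :
    (extremalMap n)^[r] (q * n + t) = (q - r) * n + (t - r : ℕ) := by
  induction r generalizing q t with
  | zero => simp
  | succ r ih =>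
    rw [Function.iterate_succ_apply, extremalMap_apply ht, ih (by omega)]
    rw [show t - 1 - r = t - (r + 1) by omega]
    push_cast; ring

/-- After n steps all digits are 0 and only the blocks count. If x is divisible by n, then x - 1
lies one block lower and meets the orbit of f x; otherwise x and x - 1 share a block. -/
theorem eventuallyMerges_extremalMap {n : ℕ} (hn : 0 < n) : EventuallyMerges (extremalMap n) := by
  intro x
  have hn' : (0 : ℤ) < n := by exact_mod_cast hn
  obtain ⟨q, t, ht, rfl⟩ : ∃ (q : ℤ) (t : ℕ), t < n ∧ x = q * n + t := by
    have h0 := Int.emod_nonneg x hn'.ne'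
    have h1 := Int.emod_lt_of_pos x hn'
    refine ⟨x / n, (x % n).toNat, by omega, ?_⟩
    rw [Int.toNat_of_nonneg h0, add_comm, Int.emod_add_ediv_mul]
  rcases t with _ | t
  · refine ⟨2 * n, ?_⟩
    rw [show 2 * n + 2 = 2 * (n + 1) by ring, (interleave_two_mul _ _ _ _).1,
      (interleave_two_mul _ _ _ _).2, iterate_extremalMap hn,
      show q * n + ((0 : ℕ) : ℤ) - 1 = (q - 1) * n + (n - 1 : ℕ) by push_cast [hn]; ring,
      iterate_extremalMap (by omega), show n - 1 - n = 0 by omega, Nat.zero_sub]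
    push_cast; ring
  · refine ⟨2 * (n - 1) + 1, ?_⟩
    rw [show 2 * (n - 1) + 1 + 1 = 2 * n by omega, show 2 * (n - 1) + 1 + 2 = 2 * n + 1 by omega,
      (interleave_two_mul _ _ _ _).1, (interleave_two_mul _ _ _ _).2, iterate_extremalMap ht,
      show q * n + ((t + 1 : ℕ) : ℤ) - 1 = q * n + t by push_cast; ring,
      iterate_extremalMap (by omega), show t - n = 0 by omega, show t + 1 - n = 0 by omega]

/-- The r-th iterates of 0 and -1 are -r n and -(r + 1) n + (n - 1 - r). Equality at an even place
would need r = -1, at an odd place r = n - 1, which lies beyond the range. -/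
theorem interleave_extremalMap_ne {n i : ℕ} (hi : i < 2 * n - 2) :
    interleave (extremalMap n) 0 (0 - 1) (i + 1) ≠ interleave (extremalMap n) 0 (0 - 1) (i + 2) := by
  have h0 : ∀ r, (extremalMap n)^[r] 0 = -r * n := fun r => by
    have := iterate_extremalMap (n := n) (t := 0) (by omega) 0 r
    simpa using this
  have h1 : ∀ r, (extremalMap n)^[r] (0 - 1) = (-1 - r) * n + (n - 1 - r : ℕ) := fun r => by
    rw [← iterate_extremalMap (by omega)]
    congr 1
    push_cast [show 1 ≤ n by omega]; ring
  obtain ⟨r, hr | hr⟩ := Nat.even_or_odd' (i + 1)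
  · rw [show i + 2 = 2 * r + 1 by omega, hr, (interleave_two_mul _ _ _ _).1,
      (interleave_two_mul _ _ _ _).2, h0, h1, Nat.sub_sub, Nat.cast_sub (by omega)]
    intro h
    push_cast at h
    have : (r : ℤ) = -1 := by linarith
    omega
  · rw [show i + 2 = 2 * (r + 1) by omega, hr, (interleave_two_mul _ _ _ _).1,
      (interleave_two_mul _ _ _ _).2, h0, h1, Nat.sub_sub, Nat.cast_sub (by omega)]
    intro h
    push_cast at h
    have : (r : ℤ) + 1 = n := by linarith
    omega


/-! ### Algebras spanned by paths on a cycle -/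

/-- Elements of `Λ` that multiply like the paths of an oriented cycle with `n` vertices, where
`path j l` is the path of length `l` that ends at `j`; it vanishes from length `len j` on. -/
structure CyclePaths (k : Type u) [Field k] (Λ : Type v) [Ring Λ] [Algebra k Λ] (n : ℕ)
    [NeZero n] where
  path : ZMod n → ℕ → Λ
  len : ZMod n → ℕ
  path_mul_path : ∀ i l j l', path i l * path j l' = if i = j - l' then path j (l' + l) else 0
  sum_path_zero : ∑ j, path j 0 = 1
  path_eq_zero_iff : ∀ j l, path j l = 0 ↔ len j ≤ l
  len_pos : ∀ j, 0 < len j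
  span_eq_top : Submodule.span k (Set.range fun x : ZMod n × ℕ => path x.1 x.2) = ⊤

namespace CyclePaths

variable {k : Type u} [Field k] {Λ : Type v} [Ring Λ] [Algebra k Λ] {n : ℕ} [NeZero n]
variable (D : CyclePaths k Λ n)

theorem path_add (j : ZMod n) (l d : ℕ) : D.path j (l + d) = D.path (j - l) d * D.path j l := by
  rw [D.path_mul_path, if_pos rfl]

theorem path_mul_path_zero (j : ZMod n) (l : ℕ) : D.path j l * D.path j 0 = D.path j l := by
  simp [D.path_mul_path]

theorem path_zero_mul_path (j : ZMod n) (l : ℕ) : D.path (j - l) 0 * D.path j l = D.path j l := by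
  simp [D.path_mul_path]

/-- The left ideal generated by the path of length `l` that ends at `j`. -/
def leftIdeal (j : ZMod n) (l : ℕ) : Submodule Λ Λ := Submodule.span Λ {D.path j l}

theorem mem_leftIdeal {j : ZMod n} {l : ℕ} {x : Λ} :
    x ∈ D.leftIdeal j l ↔ ∃ z, z * D.path j l = x := by
  simp [leftIdeal, Submodule.mem_span_singleton]

theorem mul_path_mem (z : Λ) (j : ZMod n) (l : ℕ) : z * D.path j l ∈ D.leftIdeal j l :=
  D.mem_leftIdeal.2 ⟨z, rfl⟩

theorem path_mem (j : ZMod n) (l : ℕ) : D.path j l ∈ D.leftIdeal j l :=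
  D.mem_leftIdeal.2 ⟨1, one_mul _⟩

theorem leftIdeal_antitone (j : ZMod n) : Antitone (D.leftIdeal j) := by
  intro l l' h
  obtain ⟨d, rfl⟩ := Nat.exists_eq_add_of_le h
  rw [leftIdeal, Submodule.span_singleton_le_iff_mem, D.path_add]
  exact D.mul_path_mem _ _ _

theorem mul_path_zero {j : ZMod n} {l : ℕ} {x : Λ} (hx : x ∈ D.leftIdeal j l) :
    x * D.path j 0 = x := by
  obtain ⟨z, rfl⟩ := D.mem_leftIdeal.1 hx
  rw [mul_assoc, D.path_mul_path_zero]

theorem eq_zero_of_mem {j : ZMod n} {l : ℕ} (h : D.len j ≤ l) {x : Λ}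
    (hx : x ∈ D.leftIdeal j l) : x = 0 := by
  obtain ⟨z, rfl⟩ := D.mem_leftIdeal.1 hx
  rw [(D.path_eq_zero_iff j l).2 h, mul_zero]

theorem smul_mem (c : k) {j : ZMod n} {l : ℕ} {x : Λ} (hx : x ∈ D.leftIdeal j l) :
    c • x ∈ D.leftIdeal j l := by
  rw [Algebra.smul_def]
  exact (D.leftIdeal j l).smul_mem _ hx

theorem induction_on {P : Λ → Prop} (x : Λ) (zero : P 0) (add : ∀ x y, P x → P y → P (x + y))
    (smul : ∀ (c : k) x, P x → P (c • x)) (path : ∀ j l, P (D.path j l)) : P x := by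
  have hx : x ∈ Submodule.span k (Set.range fun x : ZMod n × ℕ => D.path x.1 x.2) := by
    rw [D.span_eq_top]; trivial
  induction hx using Submodule.span_induction with
  | mem x h => obtain ⟨y, rfl⟩ := h; exact path _ _
  | zero => exact zero
  | add x y _ _ hx hy => exact add x y hx hy
  | smul c x _ hx => exact smul c x hx

theorem path_mul_mul_path_mem (i : ZMod n) (a : ℕ) (w : Λ) (j : ZMod n) (b : ℕ) :
    D.path i a * (w * D.path j b) ∈ D.leftIdeal j (b + a) := by
  induction w using D.induction_on with
  | zero => simp
  | add x y hx hy => rw [add_mul, mul_add]; exact add_mem hx hy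
  | smul c x hx => rw [smul_mul_assoc, mul_smul_comm]; exact D.smul_mem c hx
  | path q c =>
    rw [D.path_mul_path]
    split_ifs
    · rw [D.path_mul_path]
      split_ifs
      · exact D.leftIdeal_antitone j (by omega) (D.path_mem j _)
      · exact zero_mem _
    · rw [mul_zero]; exact zero_mem _

theorem path_mul_mul_path_eq_zero (i : ZMod n) {a : ℕ} (w : Λ) {j : ZMod n} {b : ℕ}
    (h : D.len j ≤ b + a) : D.path i a * (w * D.path j b) = 0 :=
  D.eq_zero_of_mem h (D.path_mul_mul_path_mem i a w j b)

/-- Only the trivial path at the source of `path j b` fails to lengthen it, so each layer of the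
filtration by length is at most one-dimensional. -/
theorem exists_smul_sub_mem (w : Λ) (j : ZMod n) (b : ℕ) :
    ∃ c : k, w * D.path j b - c • D.path j b ∈ D.leftIdeal j (b + 1) := by
  induction w using D.induction_on with
  | zero => exact ⟨0, by simp⟩
  | add x y hx hy =>
    obtain ⟨c, hc⟩ := hx
    obtain ⟨d, hd⟩ := hy
    refine ⟨c + d, ?_⟩
    rw [add_mul, add_smul, add_sub_add_comm]
    exact add_mem hc hd
  | smul a x hx =>
    obtain ⟨c, hc⟩ := hx
    refine ⟨a * c, ?_⟩
    rw [smul_mul_assoc, mul_smul, ← smul_sub]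
    exact D.smul_mem a hc
  | path q a =>
    rw [D.path_mul_path]
    split_ifs with h
    · rcases a with _ | a
      · exact ⟨1, by simp⟩
      · refine ⟨0, ?_⟩
        rw [zero_smul, sub_zero]
        exact D.leftIdeal_antitone j (by omega) (D.path_mem j _)
    · exact ⟨0, by simp⟩

theorem mem_or_exists_leading {v : ZMod n} {z : Λ} (hz : z ∈ D.leftIdeal v 0) (T : ℕ) :
    z ∈ D.leftIdeal v T ∨
      ∃ t < T, ∃ c : k, c ≠ 0 ∧ z - c • D.path v t ∈ D.leftIdeal v (t + 1) := by
  induction T with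
  | zero => exact Or.inl hz
  | succ T ih =>
    rcases ih with ih | ⟨t, ht, c, hc⟩
    · obtain ⟨w, rfl⟩ := D.mem_leftIdeal.1 ih
      obtain ⟨c, hc⟩ := D.exists_smul_sub_mem w v T
      by_cases h : c = 0
      · left; simpa [h] using hc
      · exact Or.inr ⟨T, by omega, c, h, hc⟩
    · exact Or.inr ⟨t, by omega, c, hc⟩

/-- A leading term of z too short to be killed can be prolonged until its product with the path has
length `len j - 1`; it is then nonzero while every later term has vanished. -/
theorem mul_path_eq_zero_iff {j : ZMod n} {l : ℕ} (hl : l ≤ D.len j) {z : Λ}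
    (hz : z ∈ D.leftIdeal (j - l) 0) :
    z * D.path j l = 0 ↔ z ∈ D.leftIdeal (j - l) (D.len j - l) := by
  constructor
  · intro h
    refine (D.mem_or_exists_leading hz (D.len j - l)).resolve_right ?_
    rintro ⟨t, ht, c, hc, hmem⟩
    obtain ⟨w, hw⟩ := D.mem_leftIdeal.1 hmem
    have hz' : z = c • D.path (j - l) t + w * D.path (j - l) (t + 1) := by rw [hw]; abel
    rw [hz', add_mul, smul_mul_assoc, mul_assoc, ← D.path_add, ← D.path_add] at h
    have h2 := congrArg (D.path (j - (l + t : ℕ)) (D.len j - 1 - (l + t)) * ·) h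
    simp only [mul_add, mul_smul_comm, mul_zero] at h2
    rw [← D.path_add, D.path_mul_mul_path_eq_zero _ _ (by omega), add_zero,
      smul_eq_zero_iff_right hc, D.path_eq_zero_iff] at h2
    have := D.len_pos j
    omega
  · intro h
    obtain ⟨w, rfl⟩ := D.mem_leftIdeal.1 h
    rw [mul_assoc, ← D.path_add, (D.path_eq_zero_iff _ _).2 (by omega), mul_zero]

instance projective_leftIdeal (j : ZMod n) : Module.Projective Λ (D.leftIdeal j 0) :=
  Module.Projective.of_split (D.leftIdeal j 0).subtype
    ((LinearMap.toSpanSingleton Λ Λ (D.path j 0)).codRestrict _ fun z => D.mul_path_mem z j 0)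
    (LinearMap.ext fun x => Subtype.ext (D.mul_path_zero x.2))

/-! ### Syzygies of cyclic modules -/

section Syzygy

variable {M : Type v} [AddCommGroup M] [Module Λ M]

/-- `s` generates `M`, is fixed by the idempotent at `j`, and its annihilator in the projective
module at `j` is generated by the path of length `t`. -/
structure IsGenerator (j : ZMod n) (t : ℕ) (s : M) : Prop where
  path_zero_smul : D.path j 0 • s = s
  exists_smul : ∀ y : M, ∃ z : Λ, z • s = y
  smul_eq_zero_iff : ∀ z ∈ D.leftIdeal j 0, z • s = 0 ↔ z ∈ D.leftIdeal j t

/-- The map from the projective module at `j` to `M` given by an element of `M`. -/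
def orbitMap (j : ZMod n) (s : M) : D.leftIdeal j 0 →ₗ[Λ] M :=
  (LinearMap.toSpanSingleton Λ M s).comp (D.leftIdeal j 0).subtype

theorem orbitMap_apply (j : ZMod n) (s : M) (z : D.leftIdeal j 0) :
    D.orbitMap j s z = (z : Λ) • s := rfl

namespace IsGenerator

variable {D} {j : ZMod n} {t : ℕ} {s : M}

theorem orbitMap_comp (h : D.IsGenerator j t s) :
    (D.orbitMap j s).comp (Submodule.inclusion (D.leftIdeal_antitone j (Nat.zero_le t))) = 0 := by
  ext ⟨z, hz⟩
  exact (h.smul_eq_zero_iff z (D.leftIdeal_antitone j (Nat.zero_le t) hz)).2 hz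

theorem orbitMap_surjective (h : D.IsGenerator j t s) : Function.Surjective (D.orbitMap j s) := by
  intro y
  obtain ⟨z, rfl⟩ := h.exists_smul y
  refine ⟨⟨z * D.path j 0, D.mul_path_mem _ _ _⟩, ?_⟩
  rw [orbitMap_apply, mul_smul, h.path_zero_smul]

theorem shortExact (h : D.IsGenerator j t s) :
    (ModuleCat.shortComplexOfCompEqZero (Submodule.inclusion
      (D.leftIdeal_antitone j (Nat.zero_le t))) (D.orbitMap j s) h.orbitMap_comp).ShortExact := by
  refine ModuleCat.shortComplex_shortExact _ ?_ (Submodule.inclusion_injective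
      (D.leftIdeal_antitone j (Nat.zero_le t))) h.orbitMap_surjective
  rintro ⟨z, hz⟩
  refine (h.smul_eq_zero_iff z hz).trans ⟨fun h' => ⟨⟨z, h'⟩, rfl⟩, ?_⟩
  rintro ⟨⟨y, hy⟩, hyz⟩
  obtain rfl : y = z := congrArg Subtype.val hyz
  exact hy

instance (j : ZMod n) : Projective (ModuleCat.of Λ (D.leftIdeal j 0)) :=
  (IsProjective.iff_projective _).1 (D.projective_leftIdeal j)

theorem hasProjectiveDimensionLT (h : D.IsGenerator j t s) {r : ℕ}
    (hr : HasProjectiveDimensionLT (ModuleCat.of Λ (D.leftIdeal j t)) r) :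
    HasProjectiveDimensionLT (ModuleCat.of Λ M) (r + 1) :=
  h.shortExact.hasProjectiveDimensionLT_X₃ r hr
    (hasProjectiveDimensionLT_of_ge (ModuleCat.of Λ (D.leftIdeal j 0)) 1 _ (by omega))

theorem hasProjectiveDimensionLT_syzygy (h : D.IsGenerator j t s) {r : ℕ}
    (hr : HasProjectiveDimensionLT (ModuleCat.of Λ M) (r + 2)) :
    HasProjectiveDimensionLT (ModuleCat.of Λ (D.leftIdeal j t)) (r + 1) :=
  h.shortExact.hasProjectiveDimensionLT_X₁ (r + 1)
    (hasProjectiveDimensionLT_of_ge (ModuleCat.of Λ (D.leftIdeal j 0)) 1 _ (by omega)) hr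

/-- A section sends s to `path j 0` plus an element w * `path j t`. Since `path j t` kills s, it
kills this image, whose product with it has leading term `path j t`. -/
theorem path_eq_zero_of_projective (h : D.IsGenerator j t s) (hs : s ≠ 0)
    [Module.Projective Λ M] : D.path j t = 0 := by
  have ht : 0 < t := by
    refine Nat.pos_of_ne_zero fun ht => hs ?_
    subst ht
    have := (h.smul_eq_zero_iff _ (D.path_mem j 0)).2 (D.path_mem j 0)
    rwa [h.path_zero_smul] at this
  obtain ⟨σ, hσ⟩ := Module.projective_lifting_property _ LinearMap.id h.orbitMap_surjective
  have hσs : ((σ s : D.leftIdeal j 0) : Λ) • s = s := LinearMap.congr_fun hσ s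
  have hmem : ((σ s : D.leftIdeal j 0) : Λ) - D.path j 0 ∈ D.leftIdeal j t := by
    rw [← h.smul_eq_zero_iff _ (sub_mem (σ s).2 (D.path_mem j 0)), sub_smul, hσs,
      h.path_zero_smul, sub_self]
  obtain ⟨w, hw⟩ := D.mem_leftIdeal.1 hmem
  have h0 : D.path j t * ((σ s : D.leftIdeal j 0) : Λ) = 0 := by
    have hts : D.path j t • s = 0 :=
      (h.smul_eq_zero_iff _ (D.leftIdeal_antitone j (Nat.zero_le t) (D.path_mem j t))).2
        (D.path_mem j t)
    have := congrArg Subtype.val (σ.map_smul (D.path j t) s)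
    rw [hts, map_zero] at this
    exact this.symm
  rw [show ((σ s : D.leftIdeal j 0) : Λ) = D.path j 0 + w * D.path j t by rw [hw]; abel, mul_add,
    D.path_mul_path_zero] at h0
  by_contra hne
  rw [D.path_eq_zero_iff, not_le] at hne
  -- Prolonging to length `len j - 1` kills the second summand because t > 0, and leaves a nonzero
  -- path.
  have h1 := congrArg (D.path (j - t) (D.len j - 1 - t) * ·) h0
  simp only [mul_add, mul_zero] at h1
  rw [← D.path_add, ← mul_assoc, ← D.path_add, D.path_mul_mul_path_eq_zero _ _ (by omega),
    add_zero, D.path_eq_zero_iff] at h1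
  omega

end IsGenerator

end Syzygy

theorem isGenerator_path {j : ZMod n} {l : ℕ} (hl : l ≤ D.len j) :
    D.IsGenerator (j - l) (D.len j - l) (⟨D.path j l, D.path_mem j l⟩ : D.leftIdeal j l) where
  path_zero_smul := Subtype.ext (D.path_zero_mul_path j l)
  exists_smul := by
    rintro ⟨y, hy⟩
    obtain ⟨z, rfl⟩ := D.mem_leftIdeal.1 hy
    exact ⟨z, rfl⟩
  smul_eq_zero_iff z hz := by
    rw [← D.mul_path_eq_zero_iff hl hz, Subtype.ext_iff]
    rfl

/-! ### The map on the integers -/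

/-- `x - shift x` is the length of the projective module at `x`. -/
def shift (x : ℤ) : ℤ := x - D.len (x : ZMod n)

theorem shift_equivariant (x : ℤ) : D.shift (x + n) = D.shift x + n := by
  simp [shift]; ring

/-- A path ending at x + 1 factors through its last arrow, so it vanishes as soon as the part ending
at x does: lengths grow by at most one per vertex. -/
theorem monotone_shift : Monotone D.shift := by
  refine monotone_int_of_le_succ fun x => ?_
  have h : D.path ((x : ZMod n) + 1) (1 + D.len (x : ZMod n)) = 0 := by
    rw [D.path_add, Nat.cast_one, add_sub_cancel_right, (D.path_eq_zero_iff _ _).2 le_rfl, zero_mul]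
  rw [D.path_eq_zero_iff] at h
  simp only [shift]
  push_cast
  omega

theorem shift_le_sub_one (x : ℤ) : D.shift x ≤ x - 1 := by
  have := D.len_pos (x : ZMod n)
  simp only [shift]
  omega

/-- The submodule of the projective module at `u` with composition factors at
`v, v - 1, …, shift u + 1`. -/
abbrev interval (u v : ℤ) : ModuleCat.{v} Λ := ModuleCat.of Λ (D.leftIdeal u (u - v).toNat)

theorem isGenerator_interval {u v : ℤ} (h₁ : D.shift u ≤ v) (h₂ : v ≤ u) :
    D.IsGenerator v (v - D.shift u).toNat
      (⟨D.path u (u - v).toNat, D.path_mem _ _⟩ : D.leftIdeal u (u - v).toNat) := by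
  have hv : ((u : ZMod n) - ((u - v).toNat : ZMod n)) = v := by
    rw [← Int.cast_natCast, Int.toNat_of_nonneg (by omega)]
    simp
  have hl : (u - v).toNat ≤ D.len (u : ZMod n) := by simp only [shift] at h₁; omega
  have := D.isGenerator_path hl
  rw [hv] at this
  convert this using 1
  simp only [shift]
  omega

theorem path_eq_zero_iff_le_shift {u v : ℤ} (h : v ≤ u) :
    D.path u (u - v).toNat = 0 ↔ v ≤ D.shift u := by
  rw [D.path_eq_zero_iff]
  simp only [shift]
  omega

theorem exists_interleave_eq_of_hasProjectiveDimensionLT (r : ℕ) {u v : ℤ} (h₁ : D.shift u ≤ v)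
    (h₂ : v ≤ u) (h : HasProjectiveDimensionLT (D.interval u v) r) :
    ∃ i ≤ r, interleave D.shift u v (i + 1) = interleave D.shift u v (i + 2) := by
  have hzero : D.path u (u - v).toNat = 0 → v = D.shift u := fun h =>
    le_antisymm ((D.path_eq_zero_iff_le_shift h₂).1 h) h₁
  induction r generalizing u v with
  | zero =>
    refine ⟨0, le_rfl, hzero ?_⟩
    have := ModuleCat.isZero_iff_subsingleton.1
      (isZero_of_hasProjectiveDimensionLT_zero (D.interval u v))
    exact congrArg Subtype.val (this.elim (⟨D.path u (u - v).toNat, D.path_mem _ _⟩ :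
      D.leftIdeal u (u - v).toNat) 0)
  | succ r ih =>
    by_cases hv : D.path u (u - v).toNat = 0
    · exact ⟨0, by omega, hzero hv⟩
    have hle := D.monotone_shift h₂
    -- A bound of 1 means projective; passing to syzygies is useful only from 2 on, so this case is
    -- settled by splitting the projective cover.
    rcases r with _ | r
    · refine ⟨1, le_rfl, ?_⟩
      have : Module.Projective Λ (D.leftIdeal u (u - v).toNat) :=
        (IsProjective.iff_projective _).2 (projective_iff_hasProjectiveDimensionLT_one.2 h)
      have h0 := (D.isGenerator_interval h₁ h₂).path_eq_zero_of_projective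
        (fun h => hv (congrArg Subtype.val h))
      rw [D.path_eq_zero_iff_le_shift h₁] at h0
      exact le_antisymm h0 hle
    · obtain ⟨i, hi, hi'⟩ := ih hle h₁
        ((D.isGenerator_interval h₁ h₂).hasProjectiveDimensionLT_syzygy h)
        (fun h => le_antisymm ((D.path_eq_zero_iff_le_shift h₁).1 h) hle)
      exact ⟨i + 1, by omega, hi'⟩

theorem hasProjectiveDimensionLT_of_interleave_eq (i : ℕ) {u v : ℤ} (h₁ : D.shift u ≤ v)
    (h₂ : v ≤ u) (h : interleave D.shift u v (i + 1) = interleave D.shift u v (i + 2)) :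
    HasProjectiveDimensionLT (D.interval u v) i := by
  induction i generalizing u v with
  | zero =>
    refine (ModuleCat.isZero_iff_subsingleton.2
      ⟨fun x y => Subtype.ext ?_⟩).hasProjectiveDimensionLT_zero
    have h0 : D.len (u : ZMod n) ≤ (u - v).toNat := by
      rw [← D.path_eq_zero_iff, D.path_eq_zero_iff_le_shift h₂]
      exact le_of_eq h
    rw [D.eq_zero_of_mem h0 x.2, D.eq_zero_of_mem h0 y.2]
  | succ i ih =>
    exact (D.isGenerator_interval h₁ h₂).hasProjectiveDimensionLT
      (ih (D.monotone_shift h₂) h₁ h)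

/-! ### Simple modules -/

section Simple

variable {M : Type v} [AddCommGroup M] [Module Λ M]

theorem isGenerator_one {j : ZMod n} {s : M} (hs : s ≠ 0) (h0 : D.path j 0 • s = s)
    (h1 : D.path j 1 • s = 0) (hgen : ∀ y : M, ∃ z : Λ, z • s = y) : D.IsGenerator j 1 s where
  path_zero_smul := h0
  exists_smul := hgen
  smul_eq_zero_iff z hz := by
    have hker : ∀ y ∈ D.leftIdeal j 1, y • s = 0 := by
      intro y hy
      obtain ⟨w, rfl⟩ := D.mem_leftIdeal.1 hy
      rw [mul_smul, h1, smul_zero]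
    refine ⟨fun h => (D.mem_or_exists_leading hz 1).resolve_right ?_, hker z⟩
    rintro ⟨t, ht, c, hc, hmem⟩
    obtain rfl : t = 0 := by omega
    have h2 := hker _ hmem
    rw [sub_smul, h, zero_sub, neg_eq_zero, Algebra.smul_def, mul_smul, h0] at h2
    apply hs
    rw [← one_smul Λ s, ← map_one (algebraMap k Λ), ← inv_mul_cancel₀ hc, map_mul, mul_smul, h2,
      smul_zero]

namespace IsGenerator

variable {D} {j : ZMod n} {s : M}

theorem exists_algebraMap_smul (h : D.IsGenerator j 1 s) (y : M) :
    ∃ c : k, algebraMap k Λ c • s = y := by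
  obtain ⟨z, rfl⟩ := h.exists_smul y
  obtain ⟨c, hc⟩ := D.exists_smul_sub_mem z j 0
  refine ⟨c, ?_⟩
  have h2 := (h.smul_eq_zero_iff _ (D.leftIdeal_antitone j (Nat.zero_le 1) hc)).2 hc
  rw [sub_smul, mul_smul, Algebra.smul_def, mul_smul, h.path_zero_smul, sub_eq_zero] at h2
  exact h2.symm

theorem ne_zero (h : D.IsGenerator j 1 s) : s ≠ 0 := by
  rintro rfl
  have h1 := (h.smul_eq_zero_iff _ (D.path_mem j 0)).1 (smul_zero _)
  obtain ⟨w, hw⟩ := D.mem_leftIdeal.1 h1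
  have h2 := D.path_mul_mul_path_eq_zero (j := j) j (a := D.len j - 1) w (b := 1) (by omega)
  rw [hw, D.path_mul_path_zero, D.path_eq_zero_iff] at h2
  have := D.len_pos j
  omega

theorem isSimpleModule (h : D.IsGenerator j 1 s) : IsSimpleModule Λ M := by
  refine isSimpleModule_iff_toSpanSingleton_surjective.2
    ⟨⟨s, 0, h.ne_zero⟩, fun x hx y => ?_⟩
  obtain ⟨c, rfl⟩ := h.exists_algebraMap_smul x
  obtain ⟨d, rfl⟩ := h.exists_algebraMap_smul y
  have hc : c ≠ 0 := by rintro rfl; simp at hx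
  refine ⟨algebraMap k Λ (d * c⁻¹), ?_⟩
  rw [LinearMap.toSpanSingleton_apply, ← mul_smul, ← map_mul, inv_mul_cancel_right₀ hc]

/-- The idempotent at j fixes s, but kills every multiple of s' when i ≠ j. -/
theorem eq_of_linearEquiv (h : D.IsGenerator j 1 s) {M' : Type v} [AddCommGroup M'] [Module Λ M']
    {i : ZMod n} {s' : M'} (h' : D.IsGenerator i 1 s') (e : M ≃ₗ[Λ] M') : i = j := by
  by_contra hij
  obtain ⟨c, hc⟩ := h'.exists_algebraMap_smul (e s)
  apply h.ne_zero
  rw [← e.map_eq_zero_iff, ← h.path_zero_smul, e.map_smul, ← hc, ← mul_smul,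
    ← Algebra.commutes, mul_smul]
  nth_rw 1 [← h'.path_zero_smul]
  rw [← mul_smul (D.path j 0), D.path_mul_path, if_neg (by simpa using Ne.symm hij), zero_smul,
    smul_zero]

end IsGenerator

theorem exists_isGenerator_of_isSimpleModule [IsSimpleModule Λ M] :
    ∃ (j : ZMod n) (s : M), D.IsGenerator j 1 s := by
  have := IsSimpleModule.nontrivial Λ M
  obtain ⟨s₀, hs₀⟩ := exists_ne (0 : M)
  obtain ⟨j, hj⟩ : ∃ j, D.path j 0 • s₀ ≠ 0 := by
    by_contra! h
    apply hs₀
    rw [← one_smul Λ s₀, ← D.sum_path_zero, Finset.sum_smul]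
    exact Finset.sum_eq_zero fun j _ => h j
  have hgen : ∀ x : M, x ≠ 0 → ∀ y : M, ∃ z : Λ, z • x = y := fun x hx y =>
    IsSimpleModule.toSpanSingleton_surjective Λ hx y
  have h0 : D.path j 0 • D.path j 0 • s₀ = D.path j 0 • s₀ := by
    rw [← mul_smul, D.path_mul_path_zero]
  refine ⟨j, D.path j 0 • s₀, D.isGenerator_one hj h0 ?_ (hgen _ hj)⟩
  set s := D.path j 0 • s₀
  by_contra h1
  obtain ⟨z, hz⟩ := hgen _ h1 s
  -- If the arrow did not kill s, then s would be recoverable from `path j N • s` for every N,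
  -- including N = `len j`, where the path is zero.
  have hpow : ∀ N, ∃ w : Λ, w • D.path j N • s = s := by
    intro N
    induction N with
    | zero => exact ⟨1, by rw [h0, one_smul]⟩
    | succ N ih =>
      obtain ⟨w, hw⟩ := ih
      obtain ⟨w', hw'⟩ := D.mem_leftIdeal.1 (D.path_mul_mul_path_mem j N z j 1)
      refine ⟨w * w', ?_⟩
      rw [add_comm N, ← mul_smul, mul_assoc, hw', mul_smul, mul_smul, mul_smul, hz, hw]
  obtain ⟨w, hw⟩ := hpow (D.len j)
  rw [(D.path_eq_zero_iff _ _).2 le_rfl, zero_smul, smul_zero] at hw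
  exact hj hw.symm

/-- The simple module at `j`. -/
abbrev simple (j : ZMod n) : Type v :=
  D.leftIdeal j 0 ⧸ (D.leftIdeal j 1).comap (D.leftIdeal j 0).subtype

theorem isGenerator_simple (j : ZMod n) : D.IsGenerator j 1
    (Submodule.Quotient.mk ⟨D.path j 0, D.path_mem j 0⟩ : D.simple j) where
  path_zero_smul := by
    rw [← Submodule.Quotient.mk_smul]
    exact congrArg _ (Subtype.ext (D.path_mul_path_zero j 0))
  exists_smul y := by
    obtain ⟨⟨y, hy⟩, rfl⟩ := Submodule.Quotient.mk_surjective _ y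
    refine ⟨y, ?_⟩
    rw [← Submodule.Quotient.mk_smul]
    exact congrArg _ (Subtype.ext (D.mul_path_zero hy))
  smul_eq_zero_iff z hz := by
    rw [← Submodule.Quotient.mk_smul, Submodule.Quotient.mk_eq_zero, Submodule.mem_comap]
    have : (D.leftIdeal j 0).subtype (z • ⟨D.path j 0, D.path_mem j 0⟩) = z := D.mul_path_zero hz
    rw [this]

end Simple

/-- This inequality suffices, because both bounds increase with the number of simples. -/
theorem le_of_hasNumSimples (D : CyclePaths k Λ n) {m : ℕ} (h : HasNumSimples Λ m) : n ≤ m := by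
  obtain ⟨S, -, -, hS⟩ := h
  have hex : ∀ j : ZMod n, ∃ i, Nonempty (D.simple j ≃ₗ[Λ] S i) := fun j =>
    hS (ModuleCat.of Λ (D.simple j)) (D.isGenerator_simple j).isSimpleModule
  choose g hg using hex
  have hinj : Function.Injective g := by
    intro i j hij
    obtain ⟨e⟩ := hg i
    obtain ⟨e'⟩ := hg j
    rw [hij] at e
    exact ((D.isGenerator_simple j).eq_of_linearEquiv (D.isGenerator_simple i) (e'.trans e.symm))
  have := Fintype.card_le_of_injective g hinj
  rwa [ZMod.card, Fintype.card_fin] at this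

/-! ### Global dimension and Loewy length -/

theorem finite (D : CyclePaths k Λ n) : Module.Finite k Λ := by
  have hfin : (Set.range fun x : ZMod n × ℕ => D.path x.1 x.2).Finite := by
    refine (((Set.finite_univ.prod
      (Set.finite_Iio (∑ j, D.len j))).image fun x => D.path x.1 x.2).union
        (Set.finite_singleton 0)).subset ?_
    rintro _ ⟨⟨j, l⟩, rfl⟩
    by_cases h : D.len j ≤ l
    · exact Or.inr ((D.path_eq_zero_iff j l).2 h)
    · refine Or.inl ⟨(j, l), ⟨trivial, ?_⟩, rfl⟩
      exact (not_le.1 h).trans_le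
        (Finset.single_le_sum (fun _ _ => Nat.zero_le _) (Finset.mem_univ j))
  exact ⟨⟨hfin.toFinset, by rw [Set.Finite.coe_toFinset, D.span_eq_top]⟩⟩

theorem projectiveDimension_simple_le (j : ZMod n) :
    projectiveDimension (ModuleCat.of Λ (D.simple j)) ≤ globalDimension Λ := by
  have hfin : Module.Finite Λ (ModuleCat.of Λ (D.simple j)) :=
    ⟨⟨{Submodule.Quotient.mk ⟨D.path j 0, D.path_mem j 0⟩}, by
      rw [Finset.coe_singleton, Submodule.eq_top_iff']
      exact fun y => Submodule.mem_span_singleton.2 ((D.isGenerator_simple j).exists_smul y)⟩⟩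
  exact le_iSup₂ (f := fun (M : ModuleCat.{v} Λ) (_ : Module.Finite Λ M) =>
    projectiveDimension M) _ hfin

theorem shift_le_pred (x : ℤ) : D.shift x ≤ x - 1 ∧ x - 1 ≤ x := ⟨D.shift_le_sub_one x, by omega⟩

theorem isGenerator_interval_pred {M : Type v} [AddCommGroup M] [Module Λ M] {x : ℤ} {s : M}
    (h : D.IsGenerator x 1 s) : D.IsGenerator x (x - (x - 1)).toNat s := by
  simpa using h

theorem eventuallyMerges (D : CyclePaths k Λ n) (h : globalDimension Λ < ⊤) :
    EventuallyMerges D.shift := by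
  intro x
  have hlt : projectiveDimension (ModuleCat.of Λ (D.simple x)) < ⊤ :=
    (D.projectiveDimension_simple_le x).trans_lt h
  obtain ⟨d, hd⟩ := (projectiveDimension_ne_top_iff _).1 hlt.ne
  -- The bound is weakened by one to reach the form r + 2 needed for passing to the syzygy.
  have hd' := hasProjectiveDimensionLT_of_ge (ModuleCat.of Λ (D.simple x)) (d + 1) (d + 2)
    (by omega)
  obtain ⟨i, -, hi⟩ := D.exists_interleave_eq_of_hasProjectiveDimensionLT (d + 1)
    (D.shift_le_pred x).1 (D.shift_le_pred x).2
    ((D.isGenerator_interval_pred (D.isGenerator_simple x)).hasProjectiveDimensionLT_syzygy hd')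
  exact ⟨i, hi⟩

theorem hasProjectiveDimensionLT_of_isSimpleModule (h : EventuallyMerges D.shift)
    (M : Type v) [AddCommGroup M] [Module Λ M] [IsSimpleModule Λ M] :
    HasProjectiveDimensionLT (ModuleCat.of Λ M) (2 * n - 2 + 1) := by
  obtain ⟨j, s, hs⟩ := D.exists_isGenerator_of_isSimpleModule (M := M)
  obtain ⟨x, rfl⟩ := ZMod.intCast_surjective j
  obtain ⟨i, hi, hi'⟩ := h.exists_le D.shift_equivariant x
  refine (D.isGenerator_interval_pred hs).hasProjectiveDimensionLT ?_
  have := D.hasProjectiveDimensionLT_of_interleave_eq i (D.shift_le_pred x).1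
    (D.shift_le_pred x).2 hi'
  exact hasProjectiveDimensionLT_of_ge _ i _ hi

theorem globalDimension_le (h : EventuallyMerges D.shift) :
    globalDimension Λ ≤ ((2 * n - 2 : ℕ) : WithBot ℕ∞) := by
  refine iSup₂_le fun M hM => ?_
  rw [projectiveDimension_le_iff]
  -- Finite dimension over k gives M finite length, so simple quotients and short exact sequences
  -- reduce the bound to simple modules.
  have := D.finite
  have : IsArtinianRing Λ := IsArtinianRing.of_finite k Λ
  have : IsNoetherianRing Λ := isNoetherian_of_tower k inferInstance
  have hlen : IsFiniteLength Λ M :=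
    isFiniteLength_iff_isNoetherian_isArtinian.2 ⟨inferInstance, inferInstance⟩
  suffices ∀ (M : Type v) [AddCommGroup M] [Module Λ M], IsFiniteLength Λ M →
      HasProjectiveDimensionLT (ModuleCat.of Λ M) (2 * n - 2 + 1) from this M hlen
  intro M _ _ hM
  induction hM with
  | @of_subsingleton M _ _ _ =>
    have h0 := (ModuleCat.isZero_of_subsingleton (ModuleCat.of Λ M)).hasProjectiveDimensionLT_zero
    exact hasProjectiveDimensionLT_of_ge _ 0 _ (by omega)
  | @of_simple_quotient M _ _ N _ _ ih =>
    have hS := LinearMap.shortExact_shortComplexKer N.mkQ_surjective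
    refine hS.hasProjectiveDimensionLT_X₂ _ ?_
      (D.hasProjectiveDimensionLT_of_isSimpleModule h (M ⧸ N))
    change HasProjectiveDimensionLT (ModuleCat.of Λ (LinearMap.ker N.mkQ)) _
    rw [Submodule.ker_mkQ]
    exact ih

theorem le_globalDimension {d : ℕ} {x : ℤ}
    (h : ∀ i ≤ d + 1, interleave D.shift x (x - 1) (i + 1) ≠ interleave D.shift x (x - 1) (i + 2)) :
    ((d + 2 : ℕ) : WithBot ℕ∞) ≤ globalDimension Λ := by
  refine le_trans ?_ (D.projectiveDimension_simple_le x)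
  rw [projectiveDimension_ge_iff]
  intro hd
  obtain ⟨i, hi, hi'⟩ := D.exists_interleave_eq_of_hasProjectiveDimensionLT (d + 1)
    (D.shift_le_pred x).1 (D.shift_le_pred x).2
    ((D.isGenerator_interval_pred (D.isGenerator_simple x)).hasProjectiveDimensionLT_syzygy hd)
  exact h i hi hi'

/-- The radical annihilates the simple module at the source j - l of the path, so x times the
idempotent there is a left multiple of an arrow. -/
theorem mul_path_mem_of_mem_jacobson {x : Λ} (hx : x ∈ Ring.jacobson Λ) (j : ZMod n) (l : ℕ) :
    x * D.path j l ∈ D.leftIdeal j (l + 1) := by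
  have hgen := D.isGenerator_simple (j - l)
  have := hgen.isSimpleModule
  have h0 := Module.mem_annihilator.1 (IsSemisimpleModule.jacobson_le_annihilator Λ
    (D.simple (j - l)) hx) (Submodule.Quotient.mk ⟨D.path (j - l) 0, D.path_mem (j - l) 0⟩)
  rw [← hgen.path_zero_smul, ← mul_smul, hgen.smul_eq_zero_iff _ (D.mul_path_mem _ _ _)] at h0
  obtain ⟨w, hw⟩ := D.mem_leftIdeal.1 h0
  rw [← D.path_zero_mul_path j l, ← mul_assoc, ← hw, mul_assoc, ← D.path_add]
  exact D.mul_path_mem _ _ _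

theorem jacobson_pow_le (d : ℕ) : Ring.jacobson Λ ^ d ≤ ⨆ j, D.leftIdeal j d := by
  induction d with
  | zero =>
    intro x _
    rw [← mul_one x, ← D.sum_path_zero, Finset.mul_sum]
    exact sum_mem fun j _ => Submodule.mem_iSup_of_mem j (D.mul_path_mem x j 0)
  | succ d ih =>
    rw [Ideal.IsTwoSided.pow_succ, Ideal.mul_le]
    intro x hx y hy
    have hy' := ih hy
    clear hy
    induction hy' using Submodule.iSup_induction' with
    | mem j y hy =>
      obtain ⟨w, rfl⟩ := D.mem_leftIdeal.1 hy
      rw [← mul_assoc]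
      exact Submodule.mem_iSup_of_mem j
        (D.mul_path_mem_of_mem_jacobson (Ideal.mul_mem_right _ _ hx) j d)
    | zero => rw [mul_zero]; exact zero_mem _
    | add y z _ _ hy hz => rw [mul_add]; exact add_mem hy hz

theorem loewyLength_le (D : CyclePaths k Λ n) {d : ℕ} (hd : 0 < d) (h : ∀ j, D.len j ≤ d) :
    loewyLength Λ ≤ d := by
  refine iInf₂_le d ⟨hd, ?_⟩
  rw [eq_bot_iff]
  refine (D.jacobson_pow_le d).trans (iSup_le fun j x hx => ?_)
  exact D.eq_zero_of_mem (h j) hx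

theorem bounds (D : CyclePaths k Λ n) (h : globalDimension Λ < ⊤) :
    globalDimension Λ ≤ ((2 * n - 2 : ℕ) : WithBot ℕ∞) ∧
      loewyLength Λ ≤ ((2 * n - 1 : ℕ) : ℕ∞) := by
  have hm := D.eventuallyMerges h
  have hn := NeZero.pos n
  refine ⟨D.globalDimension_le hm, D.loewyLength_le (by omega) fun j => ?_⟩
  obtain ⟨x, rfl⟩ := ZMod.intCast_surjective j
  have := hm.sub_le D.shift_equivariant D.monotone_shift x
  simp only [shift] at this
  omega

end CyclePaths


/-! ### Ideals of a path algebra that are spanned by paths -/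

namespace PathAlgebra

variable {k : Type u} [Field k] {V : Type v} [Quiver.{w} V]

variable (k) in
/-- The subspace of `kQ` spanned by a set of paths. -/
def pathSpan (s : Set (AnyPath V)) : Submodule k (PathAlgebra k V) :=
  Submodule.span k (ofPath k '' s)

theorem ofPath_mem_pathSpan_iff {s : Set (AnyPath V)} {p : AnyPath V} :
    ofPath k p ∈ pathSpan k s ↔ p ∈ s := by
  refine ⟨fun h => ?_, fun h => Submodule.subset_span ⟨p, h, rfl⟩⟩
  have h' := (basis k V).mem_span_image.1 (show basis k V p ∈ Submodule.span k (basis k V '' s)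
    from h)
  rw [Module.Basis.repr_self] at h'
  exact h' (by simp)

/-- A set of paths is absorbing if it is closed under prolongation at both ends. -/
structure IsAbsorbing (s : Set (AnyPath V)) : Prop where
  comp_left : ∀ {a b c : V} (p : Quiver.Path a b) (q : Quiver.Path b c), ⟨b, c, q⟩ ∈ s →
    (⟨a, c, p.comp q⟩ : AnyPath V) ∈ s
  comp_right : ∀ {a b c : V} (p : Quiver.Path a b) (q : Quiver.Path b c), ⟨a, b, p⟩ ∈ s →
    (⟨a, c, p.comp q⟩ : AnyPath V) ∈ s

theorem isAbsorbing_length_pos : IsAbsorbing {p : AnyPath V | 0 < p.2.2.length} where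
  comp_left p q h := by
    simp only [Set.mem_ofPred_eq, Quiver.Path.length_comp] at h ⊢
    omega
  comp_right p q h := by
    simp only [Set.mem_ofPred_eq, Quiver.Path.length_comp] at h ⊢
    omega

variable [Fintype V]

theorem IsAbsorbing.mul_mem_left {s : Set (AnyPath V)} (hs : IsAbsorbing s) (x : PathAlgebra k V)
    {y : PathAlgebra k V} (hy : y ∈ pathSpan k s) : x * y ∈ pathSpan k s := by
  induction x using induction with
  | h0 => rw [zero_mul]; exact zero_mem _
  | hadd x₁ x₂ h₁ h₂ => rw [add_mul]; exact add_mem h₁ h₂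
  | hp c p =>
    rw [smul_mul_assoc]
    refine Submodule.smul_mem _ _ ?_
    induction hy using Submodule.span_induction with
    | mem y h =>
      obtain ⟨q, hq, rfl⟩ := h
      obtain ⟨a, b, p⟩ := p
      obtain ⟨b', d, q⟩ := q
      by_cases hb : b' = b
      · subst hb
        rw [ofPath_mul_ofPath_comp, ofPath_mem_pathSpan_iff]
        exact hs.comp_left p q hq
      · rw [ofPath_mul_ofPath_of_ne _ _ hb]; exact zero_mem _
    | zero => rw [mul_zero]; exact zero_mem _
    | add y z _ _ hy hz => rw [mul_add]; exact add_mem hy hz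
    | smul c y _ hy => rw [mul_smul_comm]; exact Submodule.smul_mem _ _ hy

theorem IsAbsorbing.mul_mem_right {s : Set (AnyPath V)} (hs : IsAbsorbing s) (x : PathAlgebra k V)
    {y : PathAlgebra k V} (hy : y ∈ pathSpan k s) : y * x ∈ pathSpan k s := by
  induction x using induction with
  | h0 => rw [mul_zero]; exact zero_mem _
  | hadd x₁ x₂ h₁ h₂ => rw [mul_add]; exact add_mem h₁ h₂
  | hp c p =>
    rw [mul_smul_comm]
    refine Submodule.smul_mem _ _ ?_
    induction hy using Submodule.span_induction with
    | mem y h =>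
      obtain ⟨q, hq, rfl⟩ := h
      obtain ⟨b', d, p⟩ := p
      obtain ⟨a, b, q⟩ := q
      by_cases hb : b' = b
      · subst hb
        rw [ofPath_mul_ofPath_comp, ofPath_mem_pathSpan_iff]
        exact hs.comp_right q p hq
      · rw [ofPath_mul_ofPath_of_ne _ _ hb]; exact zero_mem _
    | zero => rw [zero_mul]; exact zero_mem _
    | add y z _ _ hy hz => rw [add_mul]; exact add_mem hy hz
    | smul c y _ hy => rw [smul_mul_assoc]; exact Submodule.smul_mem _ _ hy

variable (k) in
/-- The two-sided ideal spanned by an absorbing set of paths. -/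
def monomialIdeal {s : Set (AnyPath V)} (hs : IsAbsorbing s) : TwoSidedIdeal (PathAlgebra k V) :=
  TwoSidedIdeal.mk' (pathSpan k s) (zero_mem _) (fun hx hy => add_mem hx hy) (fun hx => neg_mem hx)
    (fun hy => hs.mul_mem_left _ hy) (fun hx => hs.mul_mem_right _ hx)

theorem mem_monomialIdeal {s : Set (AnyPath V)} (hs : IsAbsorbing s) {x : PathAlgebra k V} :
    x ∈ monomialIdeal k hs ↔ x ∈ pathSpan k s :=
  TwoSidedIdeal.mem_mk' _ _ _ _ _ _ _

theorem pathIdeal_le_monomialIdeal {s : Set (AnyPath V)} (hs : IsAbsorbing s) {t : ℕ}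
    (h : ∀ p : AnyPath V, p.2.2.length = t → p ∈ s) : pathIdeal k V t ≤ monomialIdeal k hs := by
  refine TwoSidedIdeal.span_le.2 ?_
  rintro _ ⟨p, hp, rfl⟩
  exact (mem_monomialIdeal hs).2 (ofPath_mem_pathSpan_iff.2 (h p hp))

theorem ofPath_mem_pathIdeal (p : AnyPath V) {t : ℕ} (h : t ≤ p.2.2.length) :
    ofPath k p ∈ pathIdeal k V t := by
  obtain ⟨a, b, p⟩ := p
  obtain ⟨c, q, r, rfl, hq⟩ := p.exists_eq_comp_of_le_length h
  rw [← ofPath_mul_ofPath_comp]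
  exact TwoSidedIdeal.mul_mem_right _ _ _ (TwoSidedIdeal.subset_span ⟨⟨a, c, q⟩, hq, rfl⟩)

theorem pathSpan_le_pathIdeal {s : Set (AnyPath V)} {t : ℕ}
    (h : ∀ p ∈ s, t ≤ p.2.2.length) {x : PathAlgebra k V} (hx : x ∈ pathSpan k s) :
    x ∈ pathIdeal k V t := by
  induction hx using Submodule.span_induction with
  | mem x hx => obtain ⟨p, hp, rfl⟩ := hx; exact ofPath_mem_pathIdeal p (h p hp)
  | zero => exact zero_mem _
  | add x y _ _ hx hy => exact add_mem hx hy
  | smul c x _ hx => rw [Algebra.smul_def]; exact TwoSidedIdeal.mul_mem_left _ _ _ hx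

/-- The paths of positive length span an ideal that contains `pathIdeal k V 2` and no trivial path.
-/
theorem ofPath_nil_notMem_pathIdeal (a : V) :
    ofPath k (⟨a, a, Quiver.Path.nil⟩ : AnyPath V) ∉ pathIdeal k V 2 := fun h => by
  have h' := (mem_monomialIdeal isAbsorbing_length_pos).1
    (pathIdeal_le_monomialIdeal isAbsorbing_length_pos (fun p hp => by simp [hp]) h)
  simpa using ofPath_mem_pathSpan_iff.1 h'

end PathAlgebra

/-! ### Quivers whose arrows raise a cyclic label -/

/-- A bijection of the vertices with `ℤ/n` such that every arrow goes from `j` to `j + 1`, and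
there are no parallel arrows. -/
structure CycleLabel (V : Type v) [Quiver.{w} V] (n : ℕ) where
  label : V ≃ ZMod n
  label_eq : ∀ {a b : V}, (a ⟶ b) → label b = label a + 1
  subsingleton_hom : ∀ a b : V, Subsingleton (a ⟶ b)

namespace CycleLabel

variable {V : Type v} [Quiver.{w} V] {n : ℕ} (c : CycleLabel V n)

theorem label_source {a b : V} (p : Quiver.Path a b) : c.label a = c.label b - p.length := by
  induction p with
  | nil => simp
  | cons p e ih => rw [ih, c.label_eq e]; simp

/-- A path is determined by its target and its length. -/
theorem path_ext (c : CycleLabel V n) {p q : AnyPath V} (ht : p.2.1 = q.2.1)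
    (hl : p.2.2.length = q.2.2.length) :
    p = q := by
  obtain ⟨a, b, p⟩ := p
  obtain ⟨a', b', q⟩ := q
  obtain rfl : b = b' := ht
  obtain rfl : a = a' := c.label.injective (by
    rw [c.label_source p, c.label_source q]
    exact congrArg (fun l : ℕ => c.label b - (l : ZMod n)) hl)
  congr 2
  change p.length = q.length at hl
  induction p with
  | nil =>
    exact (q.eq_nil_of_length_zero hl.symm).symm
  | @cons x y p e ih =>
    cases q with
    | nil => simp at hl
    | @cons z _ q e' =>
      obtain rfl : x = z := c.label.injective (by
        have h₁ := c.label_eq e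
        rw [c.label_eq e'] at h₁
        exact (add_right_cancel h₁).symm)
      rw [ih q (by simpa using hl), (c.subsingleton_hom x y).elim e e']

variable [Fintype V] {k : Type u} [Field k]

section Quotient

variable {Λ : Type*} [Ring Λ] [Algebra k Λ] (π : PathAlgebra k V →ₐ[k] Λ)

open Classical in
/-- The image of the path of length `l` that ends at `j`, or `0` if there is none. -/
def pathImage (j : ZMod n) (l : ℕ) : Λ :=
  if h : ∃ q : AnyPath V, c.label q.2.1 = j ∧ q.2.2.length = l then
    π (PathAlgebra.ofPath k h.choose) else 0

theorem pathImage_apply {a b : V} (p : Quiver.Path a b) :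
    c.pathImage π (c.label b) p.length = π (PathAlgebra.ofPath k ⟨a, b, p⟩) := by
  have h : ∃ q : AnyPath V, c.label q.2.1 = c.label b ∧ q.2.2.length = p.length :=
    ⟨⟨a, b, p⟩, rfl, rfl⟩
  rw [pathImage, dif_pos h]
  congr 2
  exact c.path_ext (c.label.injective h.choose_spec.1) h.choose_spec.2

theorem pathImage_eq_zero {j : ZMod n} {l : ℕ}
    (h : ¬ ∃ q : AnyPath V, c.label q.2.1 = j ∧ q.2.2.length = l) : c.pathImage π j l = 0 :=
  dif_neg h

theorem pathImage_mul_pathImage (i : ZMod n) (l : ℕ) (j : ZMod n) (l' : ℕ) :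
    c.pathImage π i l * c.pathImage π j l' =
      if i = j - l' then c.pathImage π j (l' + l) else 0 := by
  have split : ∀ {a b : V} (r : Quiver.Path a b), r.length = l' + l →
      ∃ (m : V) (p : Quiver.Path a m) (q : Quiver.Path m b), r = p.comp q ∧ p.length = l ∧
        q.length = l' := by
    intro a b r hr
    obtain ⟨m, p, q, rfl, hp⟩ := r.exists_eq_comp_of_le_length (n := l) (by omega)
    rw [Quiver.Path.length_comp] at hr
    exact ⟨m, p, q, rfl, hp, by omega⟩
  by_cases hq : ∃ q : AnyPath V, c.label q.2.1 = j ∧ q.2.2.length = l'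
  · obtain ⟨⟨m, b, q⟩, rfl, rfl⟩ := hq
    change c.pathImage π i l * c.pathImage π (c.label b) q.length =
      if i = c.label b - q.length then c.pathImage π (c.label b) (q.length + l) else 0
    rw [← c.label_source q]
    by_cases hp : ∃ p : AnyPath V, c.label p.2.1 = i ∧ p.2.2.length = l
    · obtain ⟨⟨a, m', p⟩, rfl, rfl⟩ := hp
      change c.pathImage π (c.label m') p.length * c.pathImage π (c.label b) q.length =
        if c.label m' = c.label m then c.pathImage π (c.label b) (q.length + p.length) else 0
      rw [c.pathImage_apply, c.pathImage_apply, ← map_mul]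
      split_ifs with hm
      · obtain rfl := c.label.injective hm
        rw [PathAlgebra.ofPath_mul_ofPath_comp, add_comm, ← Quiver.Path.length_comp,
          c.pathImage_apply]
      · rw [PathAlgebra.ofPath_mul_ofPath_of_ne _ _ fun h => hm (congrArg _ h.symm), map_zero]
    · rw [c.pathImage_eq_zero π hp, zero_mul]
      split_ifs with hm
      · subst hm
        -- The initial part of a path of length l' + l ending at j would be a path of length l
        -- ending at i. This case occurs for the linear quiver, where long paths do not exist.
        refine (c.pathImage_eq_zero π ?_).symm
        rintro ⟨⟨a, b', r⟩, hb, hr⟩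
        obtain rfl := c.label.injective hb
        obtain ⟨m', p, q', -, hp', hq'⟩ := split r hr
        have := c.label_source q'
        rw [hq', ← c.label_source q] at this
        exact hp ⟨⟨a, m', p⟩, this, hp'⟩
      · rfl
  · rw [c.pathImage_eq_zero π hq, mul_zero, c.pathImage_eq_zero, ite_self]
    rintro ⟨⟨a, b, r⟩, hb, hr⟩
    obtain ⟨m, p, q, -, -, hq'⟩ := split r hr
    exact hq ⟨⟨m, b, q⟩, hb, hq'⟩

theorem span_pathImage (hπ : Function.Surjective π) :
    Submodule.span k (Set.range fun x : ZMod n × ℕ => c.pathImage π x.1 x.2) = ⊤ := by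
  rw [Submodule.eq_top_iff']
  intro y
  obtain ⟨x, rfl⟩ := hπ y
  induction x using PathAlgebra.induction with
  | h0 => rw [map_zero]; exact zero_mem _
  | hadd x₁ x₂ h₁ h₂ => rw [map_add]; exact add_mem h₁ h₂
  | hp a p =>
    obtain ⟨s, t, p⟩ := p
    rw [map_smul, ← c.pathImage_apply]
    exact Submodule.smul_mem _ _ (Submodule.subset_span ⟨(c.label t, p.length), rfl⟩)

/-- The lengths at which the image vanishes form an upper set, since a longer path with the same
target has the shorter one as a right factor. The default value 0 for missing paths obeys the same
rule, so the linear and cyclic quivers need no separate treatment. -/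
theorem exists_len (t : ℕ) (ht : ∀ p : AnyPath V, p.2.2.length = t → π (PathAlgebra.ofPath k p) = 0)
    (h0 : ∀ a : V, π (PathAlgebra.ofPath k ⟨a, a, Quiver.Path.nil⟩) ≠ 0) :
    ∃ len : ZMod n → ℕ, (∀ j, 0 < len j) ∧ ∀ j l, c.pathImage π j l = 0 ↔ len j ≤ l := by
  classical
  have hex : ∀ j, ∃ l, c.pathImage π j l = 0 := by
    intro j
    refine ⟨t, ?_⟩
    by_cases h : ∃ q : AnyPath V, c.label q.2.1 = j ∧ q.2.2.length = t
    · obtain ⟨⟨a, b, q⟩, rfl, rfl⟩ := h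
      exact (c.pathImage_apply π q).trans (ht _ rfl)
    · exact c.pathImage_eq_zero π h
  refine ⟨fun j => Nat.find (hex j), fun j => Nat.pos_of_ne_zero fun h => ?_, fun j l =>
    ⟨fun h => Nat.find_min' _ h, fun h => ?_⟩⟩
  · have := Nat.find_spec (hex j)
    rw [show Nat.find (hex j) = 0 from h] at this
    obtain ⟨a, rfl⟩ := c.label.surjective j
    exact h0 a ((c.pathImage_apply π (Quiver.Path.nil (a := a))).symm.trans this)
  · obtain ⟨d, hd⟩ := Nat.exists_eq_add_of_le h
    have h1 := c.pathImage_mul_pathImage π (j - Nat.find (hex j) : ZMod n) d j (Nat.find (hex j))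
    rw [if_pos rfl, ← hd, Nat.find_spec (hex j), mul_zero] at h1
    exact h1.symm

variable [NeZero n]

theorem sum_pathImage_zero : ∑ j, c.pathImage π j 0 = 1 := by
  rw [← Equiv.sum_comp c.label, ← map_one π, PathAlgebra.one_def, map_sum]
  exact Finset.sum_congr rfl fun a _ => c.pathImage_apply π (Quiver.Path.nil (a := a))

/-- The images of the paths in a quotient of the path algebra by an admissible ideal. -/
def cyclePaths (hπ : Function.Surjective π) (len : ZMod n → ℕ) (hlen : ∀ j, 0 < len j)
    (h : ∀ j l, c.pathImage π j l = 0 ↔ len j ≤ l) : CyclePaths k Λ n where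
  path := c.pathImage π
  len := len
  path_mul_path := c.pathImage_mul_pathImage π
  sum_path_zero := c.sum_pathImage_zero π
  path_eq_zero_iff := h
  len_pos := hlen
  span_eq_top := c.span_pathImage π hπ

end Quotient

theorem exists_cyclePaths {W : Type} [Quiver.{0} W] [Fintype W] [NeZero n] (c : CycleLabel W n)
    {Λ : Type v} [Ring Λ] [Algebra k Λ] (h : IsAdmissibleQuotient k W Λ) :
    Nonempty (CyclePaths k Λ n) := by
  obtain ⟨I, hI, ⟨e⟩⟩ := h
  have := hI.isTwoSided
  let π : PathAlgebra k W →ₐ[k] Λ := e.symm.toAlgHom.comp (Ideal.Quotient.mkₐ k I)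
  have hker : ∀ x, π x = 0 ↔ x ∈ I := fun x => by
    rw [← Ideal.Quotient.eq_zero_iff_mem]
    exact e.symm.map_eq_zero_iff
  obtain ⟨t, -, ht⟩ := hI.exists_le
  obtain ⟨len, hlen, h⟩ := c.exists_len π t
    (fun p hp => (hker _).2 (ht _ (PathAlgebra.ofPath_mem_pathIdeal p hp.ge)))
    (fun a h => PathAlgebra.ofPath_nil_notMem_pathIdeal a (hI.le_two _ ((hker _).1 h)))
  exact ⟨c.cyclePaths π (e.symm.surjective.comp Ideal.Quotient.mk_surjective) len hlen h⟩

end CycleLabel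

/-- The residues modulo `n` label the elements of `Fin n`. -/
def finEquivZMod (n : ℕ) [NeZero n] : Fin n ≃ ZMod n where
  toFun i := (i.val : ZMod n)
  invFun z := ⟨z.val, z.val_lt⟩
  left_inv i := Fin.ext (ZMod.val_cast_of_lt i.isLt)
  right_inv z := ZMod.natCast_zmod_val z

/-- The labelling of the vertices of the linear quiver. -/
def linearLabel (n : ℕ) [NeZero n] : CycleLabel (LinearQuiver n) n where
  label := finEquivZMod n
  label_eq {a b} e := by
    have h : (a : Fin n).val + 1 = (b : Fin n).val := e.down
    change ((b : Fin n).val : ZMod n) = ((a : Fin n).val : ZMod n) + 1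
    rw [← h]; push_cast; rfl
  subsingleton_hom a b := inferInstanceAs (Subsingleton (PLift _))

/-- The labelling of the vertices of the cyclic quiver. -/
def cyclicLabel (n : ℕ) [NeZero n] : CycleLabel (CyclicQuiver n) n where
  label := finEquivZMod n
  label_eq {a b} e := by
    have h : ((a : Fin n).val + 1) % n = (b : Fin n).val := e.down
    change ((b : Fin n).val : ZMod n) = ((a : Fin n).val : ZMod n) + 1
    rw [← h]; simp
  subsingleton_hom a b := inferInstanceAs (Subsingleton (PLift _))

theorem exists_cyclePaths_of_isNakayama {k : Type u} [Field k] {Λ : Type v} [Ring Λ] [Algebra k Λ]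
    (h : IsNakayama k Λ) : ∃ (m : ℕ) (_ : NeZero m), Nonempty (CyclePaths k Λ m) := by
  obtain ⟨m, hm, h⟩ := h
  have : NeZero m := ⟨by omega⟩
  exact ⟨m, this, h.elim (linearLabel m).exists_cyclePaths (cyclicLabel m).exists_cyclePaths⟩

/-! ### The extremal algebra -/

section Extremal

variable (n : ℕ)

/-- The lengths of the projective modules of the extremal algebra. -/
def extremalLen (j : ZMod n) : ℕ := if j = 0 then n else n + 1

theorem le_extremalLen (j : ZMod n) : n ≤ extremalLen n j ∧ extremalLen n j ≤ n + 1 := by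
  unfold extremalLen
  split_ifs <;> omega

variable [NeZero n]

/-- The paths of the cyclic quiver that vanish in the extremal algebra. -/
def extremalPaths : Set (AnyPath (CyclicQuiver n)) :=
  {p | extremalLen n ((cyclicLabel n).label p.2.1) ≤ p.2.2.length}

theorem isAbsorbing_extremalPaths : PathAlgebra.IsAbsorbing (extremalPaths n) where
  comp_left p q h := by
    simp only [extremalPaths, Set.mem_ofPred_eq, Quiver.Path.length_comp] at h ⊢
    omega
  comp_right {a b c} p q h := by
    simp only [extremalPaths, Set.mem_ofPred_eq, Quiver.Path.length_comp] at h ⊢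
    -- Prolongation at the target can change the threshold, but only from n to n + 1, which one
    -- extra arrow makes up for.
    rcases Nat.eq_zero_or_pos q.length with hq | hq
    · obtain rfl := q.eq_of_length_zero hq
      omega
    · have h₁ := le_extremalLen n ((cyclicLabel n).label b)
      have h₂ := le_extremalLen n ((cyclicLabel n).label c)
      omega

/-- On the cycle every length is realised at every target, so `pathImage` never takes its default
value there. -/
theorem exists_path_to (b : CyclicQuiver n) (l : ℕ) :
    ∃ (a : CyclicQuiver n) (p : Quiver.Path a b), p.length = l := by
  induction l generalizing b with
  | zero => exact ⟨b, Quiver.Path.nil, rfl⟩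
  | succ l ih =>
    obtain ⟨b', ⟨e⟩⟩ : ∃ b' : CyclicQuiver n, Nonempty (b' ⟶ b) := by
      have hb : (b : Fin n).val < n := (b : Fin n).isLt
      refine ⟨(⟨((b : Fin n).val + (n - 1)) % n, Nat.mod_lt _ (NeZero.pos n)⟩ : Fin n), ⟨⟨?_⟩⟩⟩
      change (((b : Fin n).val + (n - 1)) % n + 1) % n = (b : Fin n).val
      rw [Nat.mod_add_mod, show (b : Fin n).val + (n - 1) + 1 = (b : Fin n).val + n by omega,
        Nat.add_mod_right, Nat.mod_eq_of_lt hb]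
    obtain ⟨a, p, rfl⟩ := ih b'
    exact ⟨a, p.cons e, rfl⟩

/-- The ideal that defines the extremal algebra. -/
abbrev extremalIdeal (k : Type u) [Field k] : Ideal (PathAlgebra k (CyclicQuiver n)) :=
  (PathAlgebra.monomialIdeal k (isAbsorbing_extremalPaths n)).asIdeal

variable {n} {k : Type u} [Field k]

theorem mem_extremalIdeal {x : PathAlgebra k (CyclicQuiver n)} :
    x ∈ extremalIdeal n k ↔ x ∈ PathAlgebra.pathSpan k (extremalPaths n) := by
  rw [TwoSidedIdeal.mem_asIdeal, PathAlgebra.mem_monomialIdeal]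

theorem isAdmissible_extremalIdeal (hn : 2 ≤ n) :
    PathAlgebra.IsAdmissible (extremalIdeal n k) where
  isTwoSided := inferInstance
  exists_le := by
    refine ⟨n + 1, by omega, fun x hx => TwoSidedIdeal.mem_asIdeal.2
      (PathAlgebra.pathIdeal_le_monomialIdeal _ (fun p hp => ?_) hx)⟩
    exact (le_extremalLen n _).2.trans hp.ge
  le_two x hx := PathAlgebra.pathSpan_le_pathIdeal
    (fun p hp => hn.trans ((le_extremalLen n _).1.trans hp)) (mem_extremalIdeal.1 hx)

variable (n k) in
/-- The paths in the extremal algebra. -/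
def extremalCyclePaths : CyclePaths k (PathAlgebra k (CyclicQuiver n) ⧸ extremalIdeal n k) n :=
  (cyclicLabel n).cyclePaths (Ideal.Quotient.mkₐ k (extremalIdeal n k))
    (Ideal.Quotient.mkₐ_surjective k _) (extremalLen n)
    (fun j => (NeZero.pos n).trans_le (le_extremalLen n j).1) (by
      intro j l
      obtain ⟨b, rfl⟩ := (cyclicLabel n).label.surjective j
      obtain ⟨a, p, rfl⟩ := exists_path_to n b l
      rw [CycleLabel.pathImage_apply, Ideal.Quotient.mkₐ_eq_mk, Ideal.Quotient.eq_zero_iff_mem,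
        mem_extremalIdeal, PathAlgebra.ofPath_mem_pathSpan_iff]
      rfl)

theorem shift_extremalCyclePaths : (extremalCyclePaths n k).shift = extremalMap n := by
  funext x
  change x - ((if (x : ZMod n) = 0 then n else n + 1 : ℕ) : ℤ) = _
  rw [extremalMap]
  simp only [ZMod.intCast_zmod_eq_zero_iff_dvd]
  split_ifs <;> simp

theorem globalDimension_extremal (hn : 2 ≤ n) :
    globalDimension (PathAlgebra k (CyclicQuiver n) ⧸ extremalIdeal n k) =
      ((2 * n - 2 : ℕ) : WithBot ℕ∞) := by
  have hs := shift_extremalCyclePaths (n := n) (k := k)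
  refine le_antisymm ((extremalCyclePaths n k).globalDimension_le ?_) ?_
  · rw [hs]; exact eventuallyMerges_extremalMap (NeZero.pos n)
  · obtain ⟨d, hd⟩ : ∃ d, 2 * n - 2 = d + 2 := ⟨2 * n - 4, by omega⟩
    rw [hd]
    refine (extremalCyclePaths n k).le_globalDimension (x := 0) fun i hi => ?_
    rw [hs]
    exact interleave_extremalMap_ne (by omega)

end Extremal

end NakayamaBound

end

/-! ### The two bounds and their sharpness -/

theorem theorem4 (k : Type u) [Field k] :
    (∀ (Λ : Type v) [Ring Λ] [Algebra k Λ] (n : ℕ),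
      NakayamaBound.IsNakayama k Λ →
      NakayamaBound.HasNumSimples Λ n →
      NakayamaBound.globalDimension Λ < ⊤ →
        NakayamaBound.globalDimension Λ ≤ ((2 * n - 2 : ℕ) : WithBot ℕ∞) ∧
        NakayamaBound.loewyLength Λ ≤ ((2 * n - 1 : ℕ) : ℕ∞)) ∧
    (∀ n : ℕ, 2 ≤ n →
      ∃ (I : Ideal (NakayamaBound.PathAlgebra k (NakayamaBound.CyclicQuiver n)))
        (hI : NakayamaBound.PathAlgebra.IsAdmissible I),
        letI := hI.isTwoSided
        NakayamaBound.globalDimension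
            (NakayamaBound.PathAlgebra k (NakayamaBound.CyclicQuiver n) ⧸ I) =
          ((2 * n - 2 : ℕ) : WithBot ℕ∞)) := by
  refine ⟨fun Λ _ _ n hΛ hn hfin => ?_, fun n hn => ?_⟩
  · obtain ⟨m, _, ⟨D⟩⟩ := NakayamaBound.exists_cyclePaths_of_isNakayama hΛ
    have hmn := D.le_of_hasNumSimples hn
    obtain ⟨h₁, h₂⟩ := D.bounds hfin
    refine ⟨h₁.trans ?_, h₂.trans ?_⟩
    · exact Nat.cast_le.2 (by omega)
    · exact Nat.cast_le.2 (by omega)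
  · have : NeZero n := ⟨by omega⟩
    exact ⟨_, NakayamaBound.isAdmissible_extremalIdeal hn,
      NakayamaBound.globalDimension_extremal hn⟩
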